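/- Let $f:\mathbb R^n\to\mathbb R\cup\{+\infty\}$ be a $\nu$-self-concordant barrier ($\nu>0$) for the closure of its domain: $f$ is proper, lower semicontinuous and convex, $\operatorname{dom} f=\{f<+\infty\}$ is open, $f$ is $C^3$ on $\operatorname{dom} f$, every restriction $\varphi(\tau)=f(x+\tau v)$ with $x\in\operatorname{dom}f$, $v\in\mathbb R^n$ satisfies $|\varphi'''(\tau)|\le 2\varphi''(\tau)^{3/2}$ whenever $x+\tau v\in\operatorname{dom} f$, and $\sup_{u\in\mathbb R^n}\{2\nabla f(x)^Tu-u^T\nabla^2 f(x)u\}\le\nu$ for all $x\in\operatorname{dom} f$. Let $g:\mathbb R^n\to\mathbb R\cup\{+\infty\}$ be proper, lower semicontinuous and convex. Write $\|u\|_x=(u^T\nabla^2f(x)u)^{1/2}$ for $x\in\operatorname{dom} f$. Fix $t>0$ and $\delta\ge 0$, and put $F(x;t)=f(x)+t^{-1}g(x)$ and $\operatorname{dom}F=\operatorname{dom}f\cap\operatorname{dom}g$. Let $x_t^*\in\operatorname{dom}F$ be a minimizer of $F(\cdot;t)$ over $\mathbb R^n$, with $\nabla^2 f(x_t^*)\succ0$.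 Let $x_t\in\operatorname{dom}F$ and $$\widehat F(x;t,x_t)=f(x_t)+\nabla f(x_t)^T(x-x_t)+\tfrac12(x-x_t)^T\nabla^2f(x_t)(x-x_t)+t^{-1}g(x).$$ Let $x_t^+\in\operatorname{dom}F$ be a $\delta$-solution of the problem of minimizing $\widehat F(\cdot;t,x_t)$ over $\operatorname{dom}F$, that is, $\widehat F(x_t^+;t,x_t)-\inf_{y\in\operatorname{dom}F}\widehat F(y;t,x_t)\le\delta^2/2$. Put $\lambda_t=\|x_t-x_t^*\|_{x_t^*}$ and $\lambda_t^+=\|x_t^+-x_t^*\|_{x_t^*}$. If $\lambda_t\in[0,1-\tfrac{\sqrt2}{2})$, then $$\lambda_t^+\le\frac{\delta}{1-\lambda_t}+\left(\frac{3-2\lambda_t}{1-4\lambda_t+2\lambda_t^2}\right)\lambda_t^2 .$$ Moreover, the function $(\delta,\lambda)\mapsto\frac{\delta}{1-\lambda}+\frac{3-2\lambda}{1-4\lambda+2\lambda^2}\lambda^2$ is nondecreasing in $\lambda\in[0,1-\tfrac{\sqrt2}{2})$ for each fixed $\delta\ge0$, and nondecreasing in $\delta\ge0$ for each fixed $\lambda\in[0,1-\tfrac{\sqrt2}{2})$.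 -/

import Mathlib

noncomputable section

namespace ProxNewton

/-- Effective domain `{x | f x < +∞}` of an extended-real-valued function. -/
def dom {n : ℕ} (f : EuclideanSpace ℝ (Fin n) → EReal) : Set (EuclideanSpace ℝ (Fin n)) :=
  {x | f x < ⊤}

/-- The real-valued function that agrees with `f` on `dom f` (its values elsewhere are never
used). -/
def realPart {n : ℕ} (f : EuclideanSpace ℝ (Fin n) → EReal) (x : EuclideanSpace ℝ (Fin n)) : ℝ :=
  (f x).toReal

/-- Proper, lower semicontinuous, convex functions `ℝⁿ → ℝ ∪ {+∞}`. -/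
structure IsProperLscConvex {n : ℕ} (f : EuclideanSpace ℝ (Fin n) → EReal) : Prop where
  ne_bot : ∀ x, f x ≠ ⊥
  nonempty_dom : (dom f).Nonempty
  lsc : LowerSemicontinuous f
  convex : ConvexOn ℝ (dom f) (realPart f)

/-- `grad f x u` is `∇f(x)ᵀ u`. -/
def grad {n : ℕ} (f : EuclideanSpace ℝ (Fin n) → EReal) (x u : EuclideanSpace ℝ (Fin n)) : ℝ :=
  fderiv ℝ (realPart f) x u

/-- `hess f x u v` is `uᵀ ∇²f(x) v`. -/
def hess {n : ℕ} (f : EuclideanSpace ℝ (Fin n) → EReal)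
    (x u v : EuclideanSpace ℝ (Fin n)) : ℝ :=
  fderiv ℝ (fderiv ℝ (realPart f)) x u v

/-- `∇²f(x) ≻ 0`. -/
def HessPosDef {n : ℕ} (f : EuclideanSpace ℝ (Fin n) → EReal)
    (x : EuclideanSpace ℝ (Fin n)) : Prop :=
  ∀ u, u ≠ 0 → 0 < hess f x u u

/-- The local norm `‖u‖_x = (uᵀ ∇²f(x) u)^{1/2}`. -/
def localNorm {n : ℕ} (f : EuclideanSpace ℝ (Fin n) → EReal)
    (x u : EuclideanSpace ℝ (Fin n)) : ℝ :=
  Real.sqrt (hess f x u u)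

/-- A convex function `φ` of one real variable with domain `D` is standard self-concordant if
`|φ'''| ≤ 2 (φ'')^{3/2}` on `D`. -/
def IsStdSelfConcordant1D (φ : ℝ → ℝ) (D : Set ℝ) : Prop :=
  ConvexOn ℝ D φ ∧
    ∀ τ ∈ D, |iteratedDeriv 3 φ τ| ≤ 2 * (iteratedDeriv 2 φ τ) ^ (3 / 2 : ℝ)

/-- Standard self-concordant functions: closed convex functions with open domain, three times
continuously differentiable there, whose restriction to every line is standard
self-concordant. -/
structure IsSelfConcordant {n : ℕ} (f : EuclideanSpace ℝ (Fin n) → EReal) : Prop where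
  properLscConvex : IsProperLscConvex f
  isOpen_dom : IsOpen (dom f)
  contDiffOn : ContDiffOn ℝ 3 (realPart f) (dom f)
  line : ∀ x ∈ dom f, ∀ v : EuclideanSpace ℝ (Fin n),
    IsStdSelfConcordant1D (fun τ : ℝ => realPart f (x + τ • v)) {τ : ℝ | x + τ • v ∈ dom f}

/-- `f` is a `ν`-self-concordant barrier for the closure of its domain:
`sup_u {2 ∇f(x)ᵀ u - ‖u‖_x²} ≤ ν` for all `x ∈ dom f`. -/
structure IsSelfConcordantBarrier {n : ℕ} (ν : ℝ)
    (f : EuclideanSpace ℝ (Fin n) → EReal) : Prop where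
  selfConcordant : IsSelfConcordant f
  pos : 0 < ν
  bound : ∀ x ∈ dom f, ∀ u, 2 * grad f x u - hess f x u u ≤ ν

/-- `dom F = dom f ∩ dom g`. -/
def domF {n : ℕ} (f g : EuclideanSpace ℝ (Fin n) → EReal) : Set (EuclideanSpace ℝ (Fin n)) :=
  dom f ∩ dom g

/-- The composite objective `F(x; t) = f(x) + t⁻¹ g(x)`. -/
def objective {n : ℕ} (f g : EuclideanSpace ℝ (Fin n) → EReal) (t : ℝ)
    (x : EuclideanSpace ℝ (Fin n)) : EReal :=
  f x + ((t⁻¹ : ℝ) : EReal) * g x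

/-- `x` solves the problem of minimizing `F(·; t)` over `ℝⁿ`. -/
def IsSolution {n : ℕ} (f g : EuclideanSpace ℝ (Fin n) → EReal) (t : ℝ)
    (x : EuclideanSpace ℝ (Fin n)) : Prop :=
  x ∈ domF f g ∧ ∀ y, objective f g t x ≤ objective f g t y

/-- Second-order Taylor model `Q(x; z)` of `f` around `z`. -/
def quadModel {n : ℕ} (f : EuclideanSpace ℝ (Fin n) → EReal)
    (z x : EuclideanSpace ℝ (Fin n)) : ℝ :=
  realPart f z + grad f z (x - z) + (1 / 2) * hess f z (x - z) (x - z)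

/-- The composite quadratic model `F̂(x; t, z) = Q(x; z) + t⁻¹ g(x)`. -/
def modelObjective {n : ℕ} (f g : EuclideanSpace ℝ (Fin n) → EReal) (t : ℝ)
    (z x : EuclideanSpace ℝ (Fin n)) : EReal :=
  (quadModel f z x : EReal) + ((t⁻¹ : ℝ) : EReal) * g x

/-- `x` is an exact solution of the proximal-Newton subproblem at `z`: a minimizer of
`F̂(·; t, z)` over `dom F`. -/
def IsExactSubproblemSolution {n : ℕ} (f g : EuclideanSpace ℝ (Fin n) → EReal) (t : ℝ)
    (z x : EuclideanSpace ℝ (Fin n)) : Prop :=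
  x ∈ domF f g ∧ ∀ y ∈ domF f g, modelObjective f g t z x ≤ modelObjective f g t z y

/-- `x` is a `δ`-solution of the proximal-Newton subproblem at `z`: it lies in `dom F` and its
value `F̂(x; t, z)` exceeds the optimal value over `dom F` by at most `δ² / 2`. -/
def IsDeltaSolution {n : ℕ} (f g : EuclideanSpace ℝ (Fin n) → EReal) (t δ : ℝ)
    (z x : EuclideanSpace ℝ (Fin n)) : Prop :=
  x ∈ domF f g ∧
    ∀ y ∈ domF f g,
      modelObjective f g t z x ≤ modelObjective f g t z y + ((δ ^ 2 / 2 : ℝ) : EReal)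

/-- Whenever the subproblem has an exact solution `x̄`, a `δ`-solution is a point of `dom F` with
`F̂(x) ≤ F̂(x̄) + δ² / 2`. -/
theorem isDeltaSolution_iff {n : ℕ} {f g : EuclideanSpace ℝ (Fin n) → EReal} {t δ : ℝ}
    {z x xbar : EuclideanSpace ℝ (Fin n)} (h : IsExactSubproblemSolution f g t z xbar) :
    IsDeltaSolution f g t δ z x ↔
      x ∈ domF f g ∧ modelObjective f g t z x ≤
        modelObjective f g t z xbar + ((δ ^ 2 / 2 : ℝ) : EReal) :=
  ⟨fun hx => ⟨hx.1, hx.2 xbar h.1⟩,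
    fun hx => ⟨hx.1, fun y hy => hx.2.trans (add_le_add_left (h.2 y hy) _)⟩⟩

/-- The right-hand side `δ/(1-λ) + ((3-2λ)/(1-4λ+2λ²)) λ²`. -/
def contractionBound (δ lam : ℝ) : ℝ :=
  δ / (1 - lam) + ((3 - 2 * lam) / (1 - 4 * lam + 2 * lam ^ 2)) * lam ^ 2

end ProxNewton

end

/-!
The diagonal bound `|D³F(x)[v,v,v]| ≤ 2 ‖v‖_x³` polarizes without loss to
`|D³F(x)[u,u,p]| ≤ 2 ‖u‖_x² ‖p‖_x`. Along the segment from the minimizer `x*` to `z`, with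
`λ = ‖z - x*‖_{x*}`, the squared local norms therefore satisfy differential inequalities with
solutions `(1 - λτ)^{±2}`; these give `(1 - λ) ‖u‖_{x*} ≤ ‖u‖_z` and bound the linearization error
`∇F(z)u - ∇F(x*)u - ∇²F(z)(z - x*, u)` by `(λ / (1 - λ))² ‖u‖_{x*}`.

Combining the first-order optimality of `x*` with the approximate optimality of `x⁺` for the
quadratic model leaves `‖d‖_z² ≤ δ² + 2 (λ / (1 - λ))² ‖d‖_{x*}` for `d = x⁺ - x*`. For
`X = (1 - λ) ‖d‖_{x*} ≤ ‖d‖_z` this is a quadratic inequality `X² ≤ δ² + 2RX` with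
`R = λ² / (1 - λ)³`, so `X ≤ δ + 2R`.
-/

namespace ProxNewton

open Set Filter Topology

section Polarization

lemma exists_triple_angle_eq {X Y : ℝ} (hXY : X ^ 2 + Y ^ 2 = 1) :
    ∃ p q : ℝ, p ^ 2 + q ^ 2 = 1 ∧ 4 * p ^ 3 - 3 * p = X ∧ 3 * q - 4 * q ^ 3 = Y := by
  have hnorm : ‖(⟨X, Y⟩ : ℂ)‖ = 1 := by rw [Complex.norm_eq_sqrt_sq_add_sq, hXY, Real.sqrt_one]
  refine ⟨Real.cos (Complex.arg ⟨X, Y⟩ / 3), Real.sin (Complex.arg ⟨X, Y⟩ / 3),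
    Real.cos_sq_add_sin_sq _, ?_, ?_⟩
  · rw [← Real.cos_three_mul, mul_div_cancel₀ _ three_ne_zero]
    simpa [hnorm] using Complex.norm_mul_cos_arg ⟨X, Y⟩
  · rw [← Real.sin_three_mul, mul_div_cancel₀ _ three_ne_zero]
    simpa [hnorm] using Complex.norm_mul_sin_arg ⟨X, Y⟩

-- The points are the cube roots of the unit complex number `X + iY`.
lemma exists_cubeRoots {X Y : ℝ} (hXY : X ^ 2 + Y ^ 2 = 1) :
    ∃ x y : Fin 3 → ℝ, (∀ k, x k ^ 2 + y k ^ 2 = 1) ∧ (∀ k, 4 * x k ^ 3 - 3 * x k = X) ∧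
      (∀ k, 3 * y k - 4 * y k ^ 3 = Y) ∧ ∑ k, x k = 0 ∧ ∑ k, y k = 0 ∧
      ∑ k, x k * y k = 0 ∧ ∑ k, x k ^ 2 = 3 / 2 := by
  obtain ⟨p, q, hpq, hX, hY⟩ := exists_triple_angle_eq hXY
  obtain ⟨s, hs⟩ : ∃ s : ℝ, s ^ 2 = 3 / 4 := ⟨√(3 / 4), Real.sq_sqrt (by norm_num)⟩
  refine ⟨![p, -p / 2 - s * q, -p / 2 + s * q], ![q, -q / 2 + s * p, -q / 2 - s * p], ?_⟩
  simp only [Fin.forall_fin_succ, Fin.sum_univ_three, Matrix.cons_val_zero, Matrix.cons_val_succ,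
    Matrix.cons_val_one, Matrix.cons_val, IsEmpty.forall_iff, and_true]
  grind

/-- On the unit circle a binary cubic is affine in `(x, y)` once the triple angle is fixed, and
`(X, Y / 3)` is the convex combination of the three cube roots of `X + iY` with the Fejér weights
`((4x² - 1) / 3)²`. -/
lemma exists_convexComb_cubic_eq {X Y : ℝ} (hXY : X ^ 2 + Y ^ 2 = 1) :
    ∃ w x y : Fin 3 → ℝ, (∀ k, 0 ≤ w k) ∧ ∑ k, w k = 1 ∧ (∀ k, x k ^ 2 + y k ^ 2 = 1) ∧
      ∀ a b c d : ℝ, ∑ k, w k * (a * x k ^ 3 + 3 * b * (x k ^ 2 * y k) + 3 * c * (x k * y k ^ 2)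
        + d * y k ^ 3) = a * X + b * Y := by
  obtain ⟨x, y, hxy, hX, hY, sum_x, sum_y, sum_xy, sum_x_sq⟩ := exists_cubeRoots hXY
  set w : Fin 3 → ℝ := fun k => ((4 * x k ^ 2 - 1) / 3) ^ 2
  have sum_w : ∑ k, w k = 1 := by
    have w_eq (k) : w k = (4 * x k ^ 2 + 4 * X * x k + 1) / 9 := by grind
    simp only [w_eq, ← Finset.sum_div, Finset.sum_add_distrib, ← Finset.mul_sum, sum_x, sum_x_sq,
      Finset.sum_const, Finset.card_univ, Fintype.card_fin]
    norm_num
  have sum_wx : ∑ k, w k * x k = X := by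
    have wx_eq (k) : w k * x k = (4 * x k + 4 * X * x k ^ 2 + X) / 9 := by grind
    simp only [wx_eq, ← Finset.sum_div, Finset.sum_add_distrib, ← Finset.mul_sum, sum_x, sum_x_sq,
      Finset.sum_const, Finset.card_univ, Fintype.card_fin]
    ring
  have sum_wy : ∑ k, w k * y k = Y / 3 := by
    have wy_eq (k) : w k * y k = (2 * y k + 4 * X * (x k * y k) + Y) / 9 := by grind
    simp only [wy_eq, ← Finset.sum_div, Finset.sum_add_distrib, ← Finset.mul_sum, sum_y, sum_xy,
      Finset.sum_const, Finset.card_univ, Fintype.card_fin]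
    ring
  refine ⟨w, x, y, fun k => sq_nonneg _, sum_w, hxy, fun a b c d => ?_⟩
  have cubic (k) : w k * (a * x k ^ 3 + 3 * b * (x k ^ 2 * y k) + 3 * c * (x k * y k ^ 2)
      + d * y k ^ 3) = ((a - 3 * c) * X + (3 * b - d) * Y) / 4 * w k
        + 3 / 4 * (a + c) * (w k * x k) + 3 / 4 * (b + d) * (w k * y k) := by grind
  simp only [cubic, Finset.sum_add_distrib, ← Finset.mul_sum, sum_w, sum_wx, sum_wy]
  ring

variable {E : Type*} [NormedAddCommGroup E] [NormedSpace ℝ E]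
  {T : E →L[ℝ] E →L[ℝ] E →L[ℝ] ℝ} {Q : E →L[ℝ] E →L[ℝ] ℝ} {K : ℝ}

lemma abs_apply_self_apply_comb_le {e₁ e₂ : E} {X Y : ℝ}
    (hT₁₂ : ∀ u v w, T u v w = T v u w) (hT₂₃ : ∀ u v w, T u v w = T u w v)
    (hK : ∀ x y : ℝ, x ^ 2 + y ^ 2 = 1 →
      |T (x • e₁ + y • e₂) (x • e₁ + y • e₂) (x • e₁ + y • e₂)| ≤ K)
    (hXY : X ^ 2 + Y ^ 2 = 1) : |T e₁ e₁ (X • e₁ + Y • e₂)| ≤ K := by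
  obtain ⟨w, x, y, hw, sum_w, hxy, hcubic⟩ := exists_convexComb_cubic_eq hXY
  have expand (x y : ℝ) : T (x • e₁ + y • e₂) (x • e₁ + y • e₂) (x • e₁ + y • e₂) =
      T e₁ e₁ e₁ * x ^ 3 + 3 * T e₁ e₁ e₂ * (x ^ 2 * y) + 3 * T e₁ e₂ e₂ * (x * y ^ 2)
        + T e₂ e₂ e₂ * y ^ 3 := by
    simp only [map_add, map_smul, add_apply, smul_apply, smul_eq_mul]
    rw [hT₂₃ e₁ e₂ e₁, hT₁₂ e₂ e₁ e₁, hT₂₃ e₁ e₂ e₁, hT₁₂ e₂ e₁ e₂, hT₂₃ e₂ e₂ e₁, hT₁₂ e₂ e₁ e₂]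
    ring
  have average : T e₁ e₁ (X • e₁ + Y • e₂) =
      ∑ k, w k * T (x k • e₁ + y k • e₂) (x k • e₁ + y k • e₂) (x k • e₁ + y k • e₂) := by
    simp only [expand]
    rw [hcubic, map_add, map_smul, map_smul, smul_eq_mul, smul_eq_mul, mul_comm X, mul_comm Y]
  calc |T e₁ e₁ (X • e₁ + Y • e₂)|
      ≤ ∑ k, |w k * T (x k • e₁ + y k • e₂) (x k • e₁ + y k • e₂) (x k • e₁ + y k • e₂)| := by
        rw [average]
        exact Finset.abs_sum_le_sum_abs _ _
    _ ≤ ∑ k, w k * K := by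
        refine Finset.sum_le_sum fun k _ => ?_
        rw [abs_mul, abs_of_nonneg (hw k)]
        exact mul_le_mul_of_nonneg_left (hK _ _ (hxy k)) (hw k)
    _ = K := by rw [← Finset.sum_mul, sum_w, one_mul]

lemma apply_smul_add_smul_self (hQ : ∀ u v, Q u v = Q v u) (s t : ℝ) (u v : E) :
    Q (s • u + t • v) (s • u + t • v) = s ^ 2 * Q u u + 2 * (s * t) * Q u v + t ^ 2 * Q v v := by
  simp only [map_add, map_smul, add_apply, smul_apply, smul_eq_mul]
  rw [hQ v u]
  ring

-- `e₁, e₂` is orthonormal for the form on `span {u, p}` that agrees with `Q` at `(u, p)` and has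
-- the enlarged diagonal values `α²` and `κ²`.
lemma apply_comb_self_le_one (hQ : ∀ u v, Q u v = Q v u) {u p e₁ e₂ : E} {α κ X Y x y : ℝ}
    (hα : α ≠ 0) (hκ : κ ≠ 0) (hY : Y ≠ 0) (hXY : X ^ 2 + Y ^ 2 = 1) (hu : u = α • e₁)
    (hp : p = κ • (X • e₁ + Y • e₂)) (huu : Q u u ≤ α ^ 2) (hpp : Q p p ≤ κ ^ 2)
    (hup : Q u p = α * κ * X) (hxy : x ^ 2 + y ^ 2 = 1) :
    Q (x • e₁ + y • e₂) (x • e₁ + y • e₂) ≤ 1 := by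
  set s : ℝ := (x - y * X / Y) / α with hs
  set t : ℝ := y / (Y * κ) with ht
  have coords : x • e₁ + y • e₂ = s • u + t • p := by
    rw [hs, ht, hu, hp]
    match_scalars <;> field_simp
    ring
  calc Q (x • e₁ + y • e₂) (x • e₁ + y • e₂)
      = s ^ 2 * Q u u + 2 * (s * t) * Q u p + t ^ 2 * Q p p := by
        rw [coords, apply_smul_add_smul_self hQ]
    _ ≤ s ^ 2 * α ^ 2 + 2 * (s * t) * (α * κ * X) + t ^ 2 * κ ^ 2 := by rw [hup]; gcongr
    _ = (s * α + t * κ * X) ^ 2 + (t * κ) ^ 2 * (1 - X ^ 2) := by ring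
    _ = x ^ 2 + y ^ 2 := by
        rw [← hXY, hs, ht]
        field_simp
        ring
    _ = 1 := hxy

lemma abs_apply_self_apply_le_of_sq_lt (hT₁₂ : ∀ u v w, T u v w = T v u w)
    (hT₂₃ : ∀ u v w, T u v w = T u w v) (hQ : ∀ u v, Q u v = Q v u) (hK : 0 ≤ K)
    (hTQ : ∀ v, |T v v v| ≤ K * √(Q v v) ^ 3) {u p : E} {α κ : ℝ} (hα : 0 < α) (hκ : 0 < κ)
    (hu : Q u u ≤ α ^ 2) (hp : Q p p ≤ κ ^ 2) (hup : Q u p ^ 2 < (α * κ) ^ 2) :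
    |T u u p| ≤ K * α ^ 2 * κ := by
  set X : ℝ := Q u p / (α * κ) with hX
  have hX_lt : X ^ 2 < 1 := by rwa [hX, div_pow, div_lt_one (by positivity)]
  obtain ⟨Y, hY, hXY⟩ : ∃ Y : ℝ, 0 < Y ∧ X ^ 2 + Y ^ 2 = 1 :=
    ⟨√(1 - X ^ 2), Real.sqrt_pos.2 (by linarith), by rw [Real.sq_sqrt (by linarith)]; ring⟩
  set e₁ : E := α⁻¹ • u with he₁
  set e₂ : E := Y⁻¹ • (κ⁻¹ • p - X • e₁) with he₂
  have hu_eq : u = α • e₁ := by rw [he₁, smul_inv_smul₀ hα.ne']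
  have hp_eq : p = κ • (X • e₁ + Y • e₂) := by
    rw [he₂, smul_inv_smul₀ hY.ne', add_sub_cancel, smul_inv_smul₀ hκ.ne']
  have hup_eq : Q u p = α * κ * X := by rw [hX, mul_div_cancel₀ _ (by positivity)]
  have cubic_le (x y : ℝ) (hxy : x ^ 2 + y ^ 2 = 1) :
      |T (x • e₁ + y • e₂) (x • e₁ + y • e₂) (x • e₁ + y • e₂)| ≤ K := by
    refine (hTQ _).trans (mul_le_of_le_one_right hK (pow_le_one₀ (Real.sqrt_nonneg _) ?_))
    exact Real.sqrt_le_one.2 (apply_comb_self_le_one hQ hα.ne' hκ.ne' hY.ne' hXY hu_eq hp_eq hu hp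
      hup_eq hxy)
  calc |T u u p| = α ^ 2 * κ * |T e₁ e₁ (X • e₁ + Y • e₂)| := by
        rw [← abs_of_pos (show 0 < α ^ 2 * κ by positivity), ← abs_mul]
        conv_lhs => rw [hp_eq, hu_eq]
        simp only [map_smul, smul_apply, smul_eq_mul]
        congr 1
        ring
    _ ≤ α ^ 2 * κ * K := by
        gcongr
        exact abs_apply_self_apply_comb_le hT₁₂ hT₂₃ cubic_le hXY
    _ = K * α ^ 2 * κ := by ring

theorem abs_apply_self_apply_le (hT₁₂ : ∀ u v w, T u v w = T v u w)
    (hT₂₃ : ∀ u v w, T u v w = T u w v) (hQ : ∀ u v, Q u v = Q v u) (hQ_nonneg : ∀ v, 0 ≤ Q v v)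
    (hK : 0 ≤ K) (hTQ : ∀ v, |T v v v| ≤ K * √(Q v v) ^ 3) (u p : E) :
    |T u u p| ≤ K * √(Q u u) ^ 2 * √(Q p p) := by
  have enlarged (ε : ℝ) (hε : 0 < ε) : |T u u p| ≤ K * (√(Q u u) + ε) ^ 2 * (√(Q p p) + ε) := by
    have le_sq (v : E) : Q v v ≤ (√(Q v v) + ε) ^ 2 := by
      rw [← Real.sqrt_le_left (by positivity)]
      exact le_add_of_nonneg_right hε.le
    refine abs_apply_self_apply_le_of_sq_lt hT₁₂ hT₂₃ hQ hK hTQ (by positivity) (by positivity)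
      (le_sq u) (le_sq p) ?_
    calc Q u p ^ 2 ≤ Q u u * Q p p :=
          LinearMap.BilinForm.apply_sq_le_of_symm Q.toBilinForm hQ_nonneg ⟨hQ⟩ u p
      _ = (√(Q u u) * √(Q p p)) ^ 2 := by
          rw [mul_pow, Real.sq_sqrt (hQ_nonneg u), Real.sq_sqrt (hQ_nonneg p)]
      _ < ((√(Q u u) + ε) * (√(Q p p) + ε)) ^ 2 := by
          refine pow_lt_pow_left₀ (mul_lt_mul'' ?_ ?_ ?_ ?_) (by positivity) two_ne_zero
          exacts [lt_add_of_pos_right _ hε, lt_add_of_pos_right _ hε, by positivity, by positivity]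
  have hlim : Tendsto (fun ε => K * (√(Q u u) + ε) ^ 2 * (√(Q p p) + ε)) (𝓝[>] 0)
      (𝓝 (K * √(Q u u) ^ 2 * √(Q p p))) := by
    refine tendsto_nhdsWithin_of_tendsto_nhds (Continuous.tendsto' (by fun_prop) _ _ ?_)
    simp only [add_zero]
  exact ge_of_tendsto hlim (eventually_of_mem self_mem_nhdsWithin enlarged)

end Polarization

section Comparison

variable {r τ : ℝ}

lemma one_sub_mul_pos (hr : r < 1) (hτ : τ ∈ Icc (0 : ℝ) 1) : 0 < 1 - r * τ := by
  rcases hτ.1.eq_or_lt with rfl | hτ₀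
  · simp only [mul_zero, sub_zero, zero_lt_one]
  · linarith [hτ.2, mul_lt_mul_of_pos_right hr hτ₀]

lemma hasDerivAt_one_sub_mul (r τ : ℝ) : HasDerivAt (fun σ => 1 - r * σ) (-r) τ := by
  simpa using ((hasDerivAt_id τ).const_mul r).const_sub 1

lemma sqrt_le_div_one_sub_of_lt {ψ ψ' : ℝ → ℝ} {c : ℝ} (hr : 0 ≤ r) (hrc : r < c) (hc : c < 1)
    (hψ : ∀ σ ∈ Icc (0 : ℝ) 1, HasDerivAt ψ (ψ' σ) σ)
    (hψ' : ∀ σ ∈ Icc (0 : ℝ) 1, ψ' σ ≤ 2 * √(ψ σ) ^ 3) (h0 : ψ 0 ≤ r ^ 2)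
    (hτ : τ ∈ Icc (0 : ℝ) 1) : √(ψ τ) ≤ c / (1 - c * τ) := by
  obtain ⟨s, hrs, hsc⟩ := exists_between hrc
  have hs : 0 < s := hr.trans_lt hrs
  have hB (σ : ℝ) (hσ : σ ∈ Icc (0 : ℝ) 1) : HasDerivAt (fun σ => (s / (1 - c * σ)) ^ 2)
      (2 * (s / (1 - c * σ)) ^ 2 * (c / (1 - c * σ))) σ := by
    have hne := (one_sub_mul_pos hc hσ).ne'
    refine (((hasDerivAt_const σ s).fun_div (hasDerivAt_one_sub_mul c σ) hne).fun_pow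
      2).congr_deriv ?_
    simp only [Nat.cast_ofNat, Nat.add_one_sub_one, pow_one]
    field_simp
    ring
  have ψ_le : ψ τ ≤ (s / (1 - c * τ)) ^ 2 := by
    refine image_le_of_deriv_right_lt_deriv_boundary' (B := fun σ => (s / (1 - c * σ)) ^ 2)
      (fun σ hσ => (hψ σ hσ).continuousAt.continuousWithinAt)
      (fun σ hσ => (hψ σ (Ico_subset_Icc_self hσ)).hasDerivWithinAt) ?_
      (fun σ hσ => (hB σ hσ).continuousAt.continuousWithinAt)
      (fun σ hσ => (hB σ (Ico_subset_Icc_self hσ)).hasDerivWithinAt) (fun σ hσ hσ_eq => ?_) hτ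
    · rw [mul_zero, sub_zero, div_one]
      exact h0.trans (pow_le_pow_left₀ hr hrs.le 2)
    · have hpos := one_sub_mul_pos hc (Ico_subset_Icc_self hσ)
      calc ψ' σ ≤ 2 * √(ψ σ) ^ 3 := hψ' σ (Ico_subset_Icc_self hσ)
        _ = 2 * (s / (1 - c * σ)) ^ 2 * (s / (1 - c * σ)) := by
          rw [hσ_eq, Real.sqrt_sq (by positivity)]
          ring
        _ < 2 * (s / (1 - c * σ)) ^ 2 * (c / (1 - c * σ)) := by gcongr
  have hpos := one_sub_mul_pos hc hτ
  calc √(ψ τ) ≤ s / (1 - c * τ) := (Real.sqrt_le_left (by positivity)).2 ψ_le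
    _ ≤ c / (1 - c * τ) := by gcongr

lemma sqrt_le_div_one_sub {ψ ψ' : ℝ → ℝ} (hr₀ : 0 ≤ r) (hr₁ : r < 1)
    (hψ : ∀ σ ∈ Icc (0 : ℝ) 1, HasDerivAt ψ (ψ' σ) σ)
    (hψ' : ∀ σ ∈ Icc (0 : ℝ) 1, ψ' σ ≤ 2 * √(ψ σ) ^ 3) (h0 : ψ 0 ≤ r ^ 2)
    (hτ : τ ∈ Icc (0 : ℝ) 1) : √(ψ τ) ≤ r / (1 - r * τ) := by
  have hlim : Tendsto (fun c => c / (1 - c * τ)) (𝓝[>] r) (𝓝 (r / (1 - r * τ))) :=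
    tendsto_nhdsWithin_of_tendsto_nhds
      (ContinuousAt.div (by fun_prop) (by fun_prop) (one_sub_mul_pos hr₁ hτ).ne')
  refine ge_of_tendsto hlim ?_
  filter_upwards [Ioo_mem_nhdsGT hr₁] with c hc
  exact sqrt_le_div_one_sub_of_lt hr₀ hc.1 hc.2 hψ hψ' h0 hτ

-- `(1 - r σ) ^ m` is the integrating factor of `h' = m r / (1 - r σ) h`.
lemma le_mul_one_sub_zpow {h h' : ℝ → ℝ} (m : ℤ) (hr : r < 1)
    (hh : ∀ σ ∈ Icc (0 : ℝ) 1, HasDerivAt h (h' σ) σ)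
    (hh' : ∀ σ ∈ Icc (0 : ℝ) 1, m * (h σ * (r / (1 - r * σ))) ≤ h' σ)
    (hτ : τ ∈ Icc (0 : ℝ) 1) : h 0 ≤ h τ * (1 - r * τ) ^ m := by
  have hderiv (σ : ℝ) (hσ : σ ∈ Icc (0 : ℝ) 1) : HasDerivAt (fun σ => h σ * (1 - r * σ) ^ m)
      ((h' σ - m * (h σ * (r / (1 - r * σ)))) * (1 - r * σ) ^ m) σ := by
    have hpos := one_sub_mul_pos hr hσ
    refine ((hh σ hσ).fun_mul ((hasDerivAt_zpow m _ (.inl hpos.ne')).comp σ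
      (hasDerivAt_one_sub_mul r σ))).congr_deriv ?_
    rw [Function.comp_apply, zpow_sub_one₀ hpos.ne']
    ring
  have hmono : MonotoneOn (fun σ => h σ * (1 - r * σ) ^ m) (Icc 0 1) := by
    refine monotoneOn_of_hasDerivWithinAt_nonneg (convex_Icc 0 1)
      (fun σ hσ => (hderiv σ hσ).continuousAt.continuousWithinAt)
      (fun σ hσ => (hderiv σ (interior_subset hσ)).hasDerivWithinAt) fun σ hσ => ?_
    have hσ' : σ ∈ Icc (0 : ℝ) 1 := interior_subset hσ
    exact mul_nonneg (sub_nonneg.2 (hh' σ hσ')) (zpow_nonneg (one_sub_mul_pos hr hσ').le m)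
  simpa using hmono (left_mem_Icc.2 zero_le_one) hτ hτ.1

lemma abs_le_div_one_sub_sq_mul {k k' : ℝ → ℝ} {N : ℝ} (hr : r < 1) (hk0 : k 0 = 0)
    (hk : ∀ σ ∈ Icc (0 : ℝ) 1, HasDerivAt k (k' σ) σ)
    (hk' : ∀ σ ∈ Icc (0 : ℝ) 1, |k' σ| ≤ 2 * r ^ 2 * σ / (1 - r * σ) ^ 3 * N) :
    |k 1| ≤ (r / (1 - r)) ^ 2 * N := by
  have hB (σ : ℝ) (hσ : σ ∈ Icc (0 : ℝ) 1) : HasDerivAt (fun σ => (r * σ / (1 - r * σ)) ^ 2 * N)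
      (2 * r ^ 2 * σ / (1 - r * σ) ^ 3 * N) σ := by
    have hne := (one_sub_mul_pos hr hσ).ne'
    refine (((((hasDerivAt_id σ).const_mul r).fun_div (hasDerivAt_one_sub_mul r σ)
      hne).fun_pow 2).mul_const N).congr_deriv ?_
    simp only [id, Nat.cast_ofNat, Nat.add_one_sub_one, pow_one]
    field_simp
    ring
  have hk1 := image_norm_le_of_norm_deriv_right_le_deriv_boundary' (f := k) (f' := k')
    (B := fun σ => (r * σ / (1 - r * σ)) ^ 2 * N)
    (fun σ hσ => (hk σ hσ).continuousAt.continuousWithinAt)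
    (fun σ hσ => (hk σ (Ico_subset_Icc_self hσ)).hasDerivWithinAt) (by simp [hk0])
    (fun σ hσ => (hB σ hσ).continuousAt.continuousWithinAt)
    (fun σ hσ => (hB σ (Ico_subset_Icc_self hσ)).hasDerivWithinAt)
    (fun σ hσ => hk' σ (Ico_subset_Icc_self hσ)) (right_mem_Icc.2 zero_le_one)
  simpa using hk1

end Comparison

section Derivatives

variable {E : Type*} [NormedAddCommGroup E] [NormedSpace ℝ E] {F : E → ℝ} {U : Set E} {x p : E}
  {τ : ℝ}

/-- The Hessian of `F` at `x` as a bilinear form. -/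
noncomputable def hessian (F : E → ℝ) (x : E) : E →L[ℝ] E →L[ℝ] ℝ :=
  fderiv ℝ (fderiv ℝ F) x

/-- The third derivative of `F` at `x` as a trilinear form; the last differentiation is in the
first argument. -/
noncomputable def thirdDeriv (F : E → ℝ) (x : E) : E →L[ℝ] E →L[ℝ] E →L[ℝ] ℝ :=
  fderiv ℝ (hessian F) x

/-- The local norm `‖u‖_x` induced by the Hessian of `F` at `x`; it is `0` where the Hessian form
is negative. -/
noncomputable def hessNorm (F : E → ℝ) (x u : E) : ℝ :=
  √(hessian F x u u)

/-- The second-order Taylor polynomial of `F` around `z`, evaluated at `x`. -/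
noncomputable def taylorModel (F : E → ℝ) (z x : E) : ℝ :=
  F z + fderiv ℝ F z (x - z) + (1 / 2) * hessian F z (x - z) (x - z)

lemma contDiffAt_fderiv (hF : ContDiffAt ℝ 3 F x) : ContDiffAt ℝ 2 (fderiv ℝ F) x :=
  hF.fderiv_right (by norm_num)

lemma contDiffAt_hessian (hF : ContDiffAt ℝ 3 F x) : ContDiffAt ℝ 1 (hessian F) x :=
  (contDiffAt_fderiv hF).fderiv_right (by norm_num)

lemma hasDerivAt_line (x p : E) (τ : ℝ) : HasDerivAt (fun τ : ℝ => x + τ • p) p τ := by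
  simpa using ((hasDerivAt_id τ).smul_const p).const_add x

lemma hasDerivAt_comp_line {H : Type*} [NormedAddCommGroup H] [NormedSpace ℝ H] {G : E → H}
    (hG : DifferentiableAt ℝ G (x + τ • p)) :
    HasDerivAt (fun τ : ℝ => G (x + τ • p)) (fderiv ℝ G (x + τ • p) p) τ :=
  hG.hasFDerivAt.comp_hasDerivAt τ (hasDerivAt_line x p τ)

lemma hasDerivAt_fderiv_line (hF : ContDiffAt ℝ 3 F (x + τ • p)) (u : E) :
    HasDerivAt (fun τ : ℝ => fderiv ℝ F (x + τ • p) u) (hessian F (x + τ • p) p u) τ := by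
  simpa [hessian] using (hasDerivAt_comp_line ((contDiffAt_fderiv hF).differentiableAt
    two_ne_zero)).clm_apply (hasDerivAt_const τ u)

lemma hasDerivAt_hessian_line (hF : ContDiffAt ℝ 3 F (x + τ • p)) (u v : E) :
    HasDerivAt (fun τ : ℝ => hessian F (x + τ • p) u v) (thirdDeriv F (x + τ • p) p u v) τ := by
  simpa [thirdDeriv] using ((hasDerivAt_comp_line ((contDiffAt_hessian hF).differentiableAt
    one_ne_zero)).clm_apply (hasDerivAt_const τ u)).clm_apply (hasDerivAt_const τ v)

lemma eventually_contDiffAt_line (hF : ContDiffAt ℝ 3 F x) (v : E) :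
    ∀ᶠ τ : ℝ in 𝓝 0, ContDiffAt ℝ 3 F (x + τ • v) := by
  have hline : Tendsto (fun τ : ℝ => x + τ • v) (𝓝 0) (𝓝 x) :=
    (hasDerivAt_line x v 0).continuousAt.tendsto.trans_eq (by simp)
  exact hline.eventually (hF.eventually (by simp))

lemma hessian_comm (hF : ContDiffAt ℝ 3 F x) (u v : E) : hessian F x u v = hessian F x v u :=
  hF.isSymmSndFDerivAt (by simp; norm_num) u v

lemma thirdDeriv_comm_left (hF : ContDiffAt ℝ 3 F x) (u v w : E) :
    thirdDeriv F x u v w = thirdDeriv F x v u w :=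
  DFunLike.congr_fun ((contDiffAt_fderiv hF).isSymmSndFDerivAt (by simp) u v) w

lemma thirdDeriv_comm_right (hF : ContDiffAt ℝ 3 F x) (u v w : E) :
    thirdDeriv F x u v w = thirdDeriv F x u w v := by
  have hx : ContDiffAt ℝ 3 F (x + (0 : ℝ) • u) := by simpa using hF
  have hcomm : (fun τ : ℝ => hessian F (x + τ • u) v w) =ᶠ[𝓝 0]
      fun τ => hessian F (x + τ • u) w v :=
    (eventually_contDiffAt_line hF u).mono fun τ hτ => hessian_comm hτ v w
  simpa using (hasDerivAt_hessian_line hx v w).unique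
    ((hasDerivAt_hessian_line hx w v).congr_of_eventuallyEq hcomm)

lemma deriv_deriv_line_eventuallyEq (hF : ContDiffAt ℝ 3 F x) (v : E) :
    deriv (deriv fun τ : ℝ => F (x + τ • v)) =ᶠ[𝓝 0] fun τ => hessian F (x + τ • v) v v := by
  have hcd := eventually_contDiffAt_line hF v
  have hderiv : deriv (fun τ : ℝ => F (x + τ • v)) =ᶠ[𝓝 0] fun τ => fderiv ℝ F (x + τ • v) v :=
    hcd.mono fun τ hτ => (hasDerivAt_comp_line (hτ.differentiableAt three_ne_zero)).deriv
  filter_upwards [hcd, hderiv.eventuallyEq_nhds] with τ hτ hderivτ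
  rw [hderivτ.deriv_eq, (hasDerivAt_fderiv_line hτ v).deriv]

lemma iteratedDeriv_two_line (hF : ContDiffAt ℝ 3 F x) (v : E) :
    iteratedDeriv 2 (fun τ : ℝ => F (x + τ • v)) 0 = hessian F x v v := by
  simp [iteratedDeriv_succ, (deriv_deriv_line_eventuallyEq hF v).eq_of_nhds]

lemma iteratedDeriv_three_line (hF : ContDiffAt ℝ 3 F x) (v : E) :
    iteratedDeriv 3 (fun τ : ℝ => F (x + τ • v)) 0 = thirdDeriv F x v v v := by
  have hx : ContDiffAt ℝ 3 F (x + (0 : ℝ) • v) := by simpa using hF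
  simp [iteratedDeriv_succ, (deriv_deriv_line_eventuallyEq hF v).deriv_eq,
    (hasDerivAt_hessian_line hx v v).deriv]

lemma hessian_self_nonneg_of_convexOn (hU : IsOpen U) (hF : ContDiffOn ℝ 3 F U)
    (hconv : ConvexOn ℝ U F) (hx : x ∈ U) (v : E) : 0 ≤ hessian F x v v := by
  have hcd (y : E) (hy : y ∈ U) : ContDiffAt ℝ 3 F y := hF.contDiffAt (hU.mem_nhds hy)
  set D : Set ℝ := {τ | x + τ • v ∈ U} with hD
  have hD_open : IsOpen D := hU.preimage (by fun_prop)
  have hD_zero : (0 : ℝ) ∈ D := by simpa [hD] using hx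
  have hconv_line : ConvexOn ℝ D fun τ : ℝ => F (x + τ • v) := by
    have hline : ⇑(AffineMap.lineMap x (x + v) : ℝ →ᵃ[ℝ] E) = fun τ : ℝ => x + τ • v := by
      ext τ
      simp [AffineMap.lineMap_apply, add_comm]
    have hcomp := hconv.comp_affineMap (AffineMap.lineMap x (x + v) : ℝ →ᵃ[ℝ] E)
    rwa [hline] at hcomp
  have hmono := hconv_line.monotoneOn_deriv fun τ hτ =>
    (hasDerivAt_comp_line ((hcd _ hτ).differentiableAt three_ne_zero)).differentiableAt
  have hnonneg := hmono.derivWithin_nonneg (x := 0)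
  rwa [derivWithin_of_isOpen hD_open hD_zero,
    (deriv_deriv_line_eventuallyEq (hcd x hx) v).eq_of_nhds, zero_smul, add_zero] at hnonneg

end Derivatives

section SelfConcordant

variable {E : Type*} [NormedAddCommGroup E] [NormedSpace ℝ E] {F : E → ℝ} {U : Set E} {x y : E}
  {τ : ℝ}

/-- `F` is standard self-concordant on the open set `U`: the third derivative along a line is
controlled by the second one, in the form `|D³F(x)[v,v,v]| ≤ 2 ‖v‖_x³`. Closedness of `F` is not
part of the definition. -/
structure SelfConcordantOn (F : E → ℝ) (U : Set E) : Prop where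
  isOpen : IsOpen U
  convexOn : ConvexOn ℝ U F
  contDiffOn : ContDiffOn ℝ 3 F U
  abs_thirdDeriv_self_le : ∀ x ∈ U, ∀ v, |thirdDeriv F x v v v| ≤ 2 * hessNorm F x v ^ 3

lemma hessNorm_nonneg (F : E → ℝ) (x u : E) : 0 ≤ hessNorm F x u :=
  Real.sqrt_nonneg _

namespace SelfConcordantOn

lemma contDiffAt (hF : SelfConcordantOn F U) (hx : x ∈ U) : ContDiffAt ℝ 3 F x :=
  hF.contDiffOn.contDiffAt (hF.isOpen.mem_nhds hx)

lemma hessian_self_nonneg (hF : SelfConcordantOn F U) (hx : x ∈ U) (u : E) :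
    0 ≤ hessian F x u u :=
  hessian_self_nonneg_of_convexOn hF.isOpen hF.contDiffOn hF.convexOn hx u

lemma sq_hessNorm (hF : SelfConcordantOn F U) (hx : x ∈ U) (u : E) :
    hessNorm F x u ^ 2 = hessian F x u u :=
  Real.sq_sqrt (hF.hessian_self_nonneg hx u)

lemma abs_thirdDeriv_le (hF : SelfConcordantOn F U) (hx : x ∈ U) (p u : E) :
    |thirdDeriv F x p u u| ≤ 2 * hessNorm F x u ^ 2 * hessNorm F x p := by
  have hcd := hF.contDiffAt hx
  rw [thirdDeriv_comm_left hcd, thirdDeriv_comm_right hcd]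
  exact abs_apply_self_apply_le (thirdDeriv_comm_left hcd) (thirdDeriv_comm_right hcd)
    (hessian_comm hcd) (hF.hessian_self_nonneg hx) zero_le_two (hF.abs_thirdDeriv_self_le x hx) u p

lemma line_mem (hF : SelfConcordantOn F U) (hx : x ∈ U) (hy : y ∈ U) (hτ : τ ∈ Icc (0 : ℝ) 1) :
    x + τ • (y - x) ∈ U :=
  hF.convexOn.1.add_smul_sub_mem hx hy hτ

lemma hasDerivAt_hessian_line (hF : SelfConcordantOn F U) (hx : x ∈ U) (hy : y ∈ U)
    (hτ : τ ∈ Icc (0 : ℝ) 1) (u v : E) :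
    HasDerivAt (fun τ : ℝ => hessian F (x + τ • (y - x)) u v)
      (thirdDeriv F (x + τ • (y - x)) (y - x) u v) τ :=
  ProxNewton.hasDerivAt_hessian_line (hF.contDiffAt (hF.line_mem hx hy hτ)) u v

lemma hessNorm_sub_line_le (hF : SelfConcordantOn F U) (hx : x ∈ U) (hy : y ∈ U)
    (hr : hessNorm F x (y - x) < 1) (hτ : τ ∈ Icc (0 : ℝ) 1) :
    hessNorm F (x + τ • (y - x)) (y - x) ≤
      hessNorm F x (y - x) / (1 - hessNorm F x (y - x) * τ) := by
  refine sqrt_le_div_one_sub (ψ := fun τ => hessian F (x + τ • (y - x)) (y - x) (y - x))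
    (hessNorm_nonneg F x _) hr (fun σ hσ => hF.hasDerivAt_hessian_line hx hy hσ _ _)
    (fun σ hσ => (le_abs_self _).trans (hF.abs_thirdDeriv_self_le _ (hF.line_mem hx hy hσ) _))
    ?_ hτ
  simp only [zero_smul, add_zero, hF.sq_hessNorm hx, le_refl]

lemma abs_thirdDeriv_line_le (hF : SelfConcordantOn F U) (hx : x ∈ U) (hy : y ∈ U)
    (hr : hessNorm F x (y - x) < 1) (hτ : τ ∈ Icc (0 : ℝ) 1) (u : E) :
    |thirdDeriv F (x + τ • (y - x)) (y - x) u u| ≤ 2 * (hessian F (x + τ • (y - x)) u u *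
      (hessNorm F x (y - x) / (1 - hessNorm F x (y - x) * τ))) := by
  have hmem := hF.line_mem hx hy hτ
  have hnonneg := hF.hessian_self_nonneg hmem u
  refine (hF.abs_thirdDeriv_le hmem _ _).trans ?_
  rw [hF.sq_hessNorm hmem, mul_assoc]
  gcongr
  exact hF.hessNorm_sub_line_le hx hy hr hτ

lemma hessNorm_line_le (hF : SelfConcordantOn F U) (hx : x ∈ U) (hy : y ∈ U)
    (hr : hessNorm F x (y - x) < 1) (hτ : τ ∈ Icc (0 : ℝ) 1) (u : E) :
    hessNorm F (x + τ • (y - x)) u ≤ hessNorm F x u / (1 - hessNorm F x (y - x) * τ) := by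
  have hpos := one_sub_mul_pos hr hτ
  have hupper := le_mul_one_sub_zpow (h := fun τ => -hessian F (x + τ • (y - x)) u u) 2 hr
    (fun σ hσ => (hF.hasDerivAt_hessian_line hx hy hσ u u).fun_neg)
    (fun σ hσ => by
      have hle := (abs_le.1 (hF.abs_thirdDeriv_line_le hx hy hr hσ u)).2
      push_cast
      linarith) hτ
  simp only [zero_smul, add_zero, neg_mul, neg_le_neg_iff, zpow_ofNat] at hupper
  rw [le_div_iff₀ hpos, ← Real.sqrt_sq hpos.le, hessNorm, ← Real.sqrt_mul' _ (sq_nonneg _)]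
  exact Real.sqrt_le_sqrt hupper

lemma hessNorm_mul_one_sub_le (hF : SelfConcordantOn F U) (hx : x ∈ U) (hy : y ∈ U)
    (hr : hessNorm F x (y - x) < 1) (u : E) :
    hessNorm F x u * (1 - hessNorm F x (y - x)) ≤ hessNorm F y u := by
  have hpos : 0 < 1 - hessNorm F x (y - x) := sub_pos.2 hr
  have hlower := le_mul_one_sub_zpow (h := fun τ => hessian F (x + τ • (y - x)) u u) (-2) hr
    (fun σ hσ => hF.hasDerivAt_hessian_line hx hy hσ u u)
    (fun σ hσ => by
      have hge := (abs_le.1 (hF.abs_thirdDeriv_line_le hx hy hr hσ u)).1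
      push_cast
      linarith) (right_mem_Icc.2 zero_le_one)
  simp only [zero_smul, add_zero, one_smul, add_sub_cancel, mul_one, zpow_neg, zpow_ofNat,
    ← div_eq_mul_inv, le_div_iff₀ (pow_pos hpos 2)] at hlower
  rw [← Real.sqrt_sq hpos.le, hessNorm, ← Real.sqrt_mul' _ (sq_nonneg _)]
  exact Real.sqrt_le_sqrt hlower

-- Evaluating the Hessian at the far end `y` cancels the second derivative of `F` in the derivative
-- along the segment, which leaves the third derivative only.
lemma abs_fderiv_sub_sub_hessian_le (hF : SelfConcordantOn F U) (hx : x ∈ U) (hy : y ∈ U)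
    (hr : hessNorm F x (y - x) < 1) (u : E) :
    |fderiv ℝ F y u - fderiv ℝ F x u - hessian F y (y - x) u| ≤
      (hessNorm F x (y - x) / (1 - hessNorm F x (y - x))) ^ 2 * hessNorm F x u := by
  set p := y - x with hp
  set r := hessNorm F x p
  have hderiv (σ : ℝ) (hσ : σ ∈ Icc (0 : ℝ) 1) : HasDerivAt
      (fun σ => fderiv ℝ F (x + σ • p) u - fderiv ℝ F x u - σ * hessian F (x + σ • p) p u)
      (-(σ * thirdDeriv F (x + σ • p) p p u)) σ := by
    refine (((hasDerivAt_fderiv_line (hF.contDiffAt (hF.line_mem hx hy hσ)) u).sub_const _).fun_sub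
      ((hasDerivAt_id σ).fun_mul (hF.hasDerivAt_hessian_line hx hy hσ p u))).congr_deriv ?_
    simp only [id, one_mul, ← hp, sub_add_cancel_left]
  have hbound (σ : ℝ) (hσ : σ ∈ Icc (0 : ℝ) 1) : |(-(σ * thirdDeriv F (x + σ • p) p p u))| ≤
      2 * r ^ 2 * σ / (1 - r * σ) ^ 3 * hessNorm F x u := by
    have hmem := hF.line_mem hx hy hσ
    have hcd := hF.contDiffAt hmem
    have hσ₀ := hσ.1
    have hp_nonneg := hessNorm_nonneg F (x + σ • p) p
    have hu_nonneg := hessNorm_nonneg F (x + σ • p) u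
    rw [abs_neg, abs_mul, abs_of_nonneg hσ₀, thirdDeriv_comm_right hcd, thirdDeriv_comm_left hcd]
    calc σ * |thirdDeriv F (x + σ • p) u p p|
        ≤ σ * (2 * hessNorm F (x + σ • p) p ^ 2 * hessNorm F (x + σ • p) u) := by
          gcongr
          exact hF.abs_thirdDeriv_le hmem u p
      _ ≤ σ * (2 * (r / (1 - r * σ)) ^ 2 * (hessNorm F x u / (1 - r * σ))) := by
          gcongr
          exacts [hF.hessNorm_sub_line_le hx hy hr hσ, hF.hessNorm_line_le hx hy hr hσ u]
      _ = 2 * r ^ 2 * σ / (1 - r * σ) ^ 3 * hessNorm F x u := by field_simp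
  have hone := abs_le_div_one_sub_sq_mul hr (by simp) hderiv hbound
  simpa only [one_smul, one_mul, hp, add_sub_cancel] using hone

end SelfConcordantOn

end SelfConcordant

section ProximalNewton

variable {E : Type*} [NormedAddCommGroup E] [NormedSpace ℝ E] {F G : E → ℝ} {V : Set E}
  {x y z : E} {δ : ℝ}

lemma fderiv_sub_add_sub_nonneg_of_isLocalMinOn (hF : DifferentiableAt ℝ F x)
    (hG : ConvexOn ℝ V G) (hmin : IsLocalMinOn (fun x => F x + G x) V x) (hx : x ∈ V)
    (hy : y ∈ V) : 0 ≤ fderiv ℝ F x (y - x) + (G y - G x) := by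
  have hderiv : HasDerivAt (fun s : ℝ => F (x + s • (y - x)) + s * (G y - G x))
      (fderiv ℝ F x (y - x) + (G y - G x)) 0 := by
    have hline := hasDerivAt_comp_line (x := x) (p := y - x) (τ := 0) (by simpa using hF)
    simpa using hline.fun_add ((hasDerivAt_id (0 : ℝ)).mul_const (G y - G x))
  have hline_mem : ∀ᶠ s : ℝ in 𝓝[>] 0, x + s • (y - x) ∈ V := by
    filter_upwards [Ioc_mem_nhdsGT zero_lt_one] with s hs
    exact hG.1.add_smul_sub_mem hx hy (Ioc_subset_Icc_self hs)
  have hline : Tendsto (fun s : ℝ => x + s • (y - x)) (𝓝[>] 0) (𝓝[V] x) :=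
    tendsto_nhdsWithin_iff.2 ⟨tendsto_nhdsWithin_of_tendsto_nhds
      (Continuous.tendsto' (by fun_prop) _ _ (by simp)), hline_mem⟩
  refine ge_of_tendsto ((hasDerivWithinAt_iff_tendsto_slope' self_notMem_Ioi).1
    (hderiv.hasDerivWithinAt (s := Ioi 0))) ?_
  filter_upwards [Ioc_mem_nhdsGT zero_lt_one, hline.eventually hmin] with s hs hs_min
  have hG_line : G (x + s • (y - x)) ≤ G x + s * (G y - G x) := by
    calc G (x + s • (y - x)) = G ((1 - s) • x + s • y) := by congr 1; module
      _ ≤ (1 - s) * G x + s * G y :=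
        hG.2 hx hy (sub_nonneg.2 hs.2) hs.1.le (sub_add_cancel 1 s)
      _ = G x + s * (G y - G x) := by ring
  rw [slope_def_field]
  refine div_nonneg ?_ (sub_nonneg.2 hs.1.le)
  simp only [zero_smul, add_zero, zero_mul]
  linarith

lemma taylorModel_sub_taylorModel (hF : ContDiffAt ℝ 3 F z) :
    taylorModel F z y - taylorModel F z x = fderiv ℝ F z (y - x) - hessian F z (z - x) (y - x)
      + (1 / 2) * hessian F z (y - x) (y - x) := by
  have hfirst : fderiv ℝ F z (y - z) = fderiv ℝ F z (x - z) + fderiv ℝ F z (y - x) := by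
    rw [← map_add]
    congr 1
    abel
  have hsecond : hessian F z (y - z) (y - z) = hessian F z (x - z) (x - z)
      + 2 * hessian F z (x - z) (y - x) + hessian F z (y - x) (y - x) := by
    have hsum := apply_smul_add_smul_self (hessian_comm hF) 1 1 (x - z) (y - x)
    simp only [one_smul, sub_add_sub_cancel'] at hsum
    rw [hsum]
    ring
  have hneg : hessian F z (z - x) (y - x) = -hessian F z (x - z) (y - x) := by
    rw [← neg_sub, map_neg, neg_apply]
  rw [taylorModel, taylorModel, hfirst, hsecond, hneg]
  ring

lemma le_add_two_mul_of_sq_le {X R : ℝ} (hδ : 0 ≤ δ) (hR : 0 ≤ R)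
    (hX : X ^ 2 ≤ δ ^ 2 + 2 * R * X) : X ≤ δ + 2 * R := by
  by_contra! hlt
  nlinarith [mul_nonneg hδ hR]

end ProximalNewton

section ContractionBound

variable {δ lam : ℝ}

lemma lt_half_of_lt_one_sub_sqrt (h : lam < 1 - √2 / 2) : lam < 1 / 2 := by
  have hsqrt : (1 : ℝ) < √2 := Real.one_lt_sqrt_two
  linarith

lemma contractionBound_den_pos (h : lam < 1 - √2 / 2) : 0 < 1 - 4 * lam + 2 * lam ^ 2 := by
  have hsq : (√2 / 2) ^ 2 < (1 - lam) ^ 2 :=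
    pow_lt_pow_left₀ (by linarith) (by positivity) two_ne_zero
  rw [div_pow, Real.sq_sqrt zero_le_two] at hsq
  linarith

lemma le_contractionBound (h : lam < 1 - √2 / 2) :
    δ / (1 - lam) + 2 * lam ^ 2 / (1 - lam) ^ 4 ≤ contractionBound δ lam := by
  have hhalf := lt_half_of_lt_one_sub_sqrt h
  have hden := contractionBound_den_pos h
  have hden_le : 1 - 4 * lam + 2 * lam ^ 2 ≤ (1 - lam) ^ 4 := by
    linear_combination sq_nonneg (lam * (2 - lam))
  have hnum_le : 2 ≤ 3 - 2 * lam := by linarith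
  rw [contractionBound, mul_div_right_comm]
  gcongr

lemma monotoneOn_contractionBound_right (hδ : 0 ≤ δ) :
    MonotoneOn (fun lam : ℝ => contractionBound δ lam) (Ico 0 (1 - √2 / 2)) := by
  intro a ha b hb hab
  have ha₀ : 0 ≤ a := ha.1
  have hb₀ : 0 ≤ b := hb.1
  have hb₁ : 0 < 1 - b := by linarith [lt_half_of_lt_one_sub_sqrt hb.2]
  have ha₁ : 0 ≤ 1 - a := by linarith
  have hden := contractionBound_den_pos hb.2
  have hnum_nonneg : 0 ≤ (3 - 2 * b) * b ^ 2 := mul_nonneg (by linarith) (sq_nonneg b)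
  have hnum : (3 - 2 * a) * a ^ 2 ≤ (3 - 2 * b) * b ^ 2 := by
    have hslope : 0 ≤ 2 * a * (1 - a) + 2 * b * (1 - b) + a * (1 - b) + b * (1 - a) := by
      positivity
    linear_combination mul_nonneg (sub_nonneg.2 hab) hslope
  have hden_le : 1 - 4 * b + 2 * b ^ 2 ≤ 1 - 4 * a + 2 * a ^ 2 := by
    linear_combination 2 * mul_nonneg (sub_nonneg.2 hab) (show 0 ≤ 2 - a - b by linarith)
  simp only [contractionBound, div_mul_eq_mul_div]
  gcongr

lemma monotone_contractionBound_left (h : lam < 1) :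
    Monotone fun δ : ℝ => contractionBound δ lam :=
  fun _ _ hab => add_le_add_left (div_le_div_of_nonneg_right hab (sub_pos.2 h).le) _

end ContractionBound

section ExtendedReal

variable {n : ℕ} {f g : EuclideanSpace ℝ (Fin n) → EReal} {t δ : ℝ}
  {x z : EuclideanSpace ℝ (Fin n)}

lemma IsSelfConcordant.selfConcordantOn (hf : IsSelfConcordant f) :
    SelfConcordantOn (realPart f) (dom f) where
  isOpen := hf.isOpen_dom
  convexOn := hf.properLscConvex.convex
  contDiffOn := hf.contDiffOn
  abs_thirdDeriv_self_le x hx v := by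
    have hcd := hf.contDiffOn.contDiffAt (hf.isOpen_dom.mem_nhds hx)
    have hnonneg := hessian_self_nonneg_of_convexOn hf.isOpen_dom hf.contDiffOn
      hf.properLscConvex.convex hx v
    have hline := (hf.line x hx v).2 0 (by simpa using hx)
    rw [iteratedDeriv_two_line hcd, iteratedDeriv_three_line hcd] at hline
    rwa [hessNorm, ← Real.rpow_natCast, ← Real.rpow_div_two_eq_sqrt _ hnonneg, Nat.cast_ofNat]

lemma coe_realPart (hfx : f x ≠ ⊥) (hx : x ∈ dom f) : (realPart f x : EReal) = f x :=
  EReal.coe_toReal (LT.lt.ne hx) hfx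

lemma objective_eq_coe (hf : ∀ x, f x ≠ ⊥) (hg : ∀ x, g x ≠ ⊥) (t : ℝ) (hx : x ∈ domF f g) :
    objective f g t x = ((realPart f x + t⁻¹ * realPart g x : ℝ) : EReal) := by
  rw [objective, ← coe_realPart (hf x) hx.1, ← coe_realPart (hg x) hx.2, EReal.coe_add,
    EReal.coe_mul]

lemma modelObjective_eq_coe (hg : ∀ x, g x ≠ ⊥) (t : ℝ) (hx : x ∈ dom g) :
    modelObjective f g t z x =
      ((taylorModel (realPart f) z x + t⁻¹ * realPart g x : ℝ) : EReal) := by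
  rw [modelObjective, ← coe_realPart (hg x) hx, EReal.coe_add, EReal.coe_mul]
  rfl

lemma IsSolution.isLocalMinOn (hx : IsSolution f g t x) (hf : IsSelfConcordant f)
    (hg : ∀ x, g x ≠ ⊥) :
    IsLocalMinOn (fun x => realPart f x + t⁻¹ * realPart g x) (dom g) x := by
  filter_upwards [self_mem_nhdsWithin, mem_nhdsWithin_of_mem_nhds (hf.isOpen_dom.mem_nhds hx.1.1)]
    with y hyg hyf
  have hle := hx.2 y
  rwa [objective_eq_coe hf.properLscConvex.ne_bot hg t hx.1,
    objective_eq_coe hf.properLscConvex.ne_bot hg t ⟨hyf, hyg⟩, EReal.coe_le_coe_iff] at hle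

lemma IsDeltaSolution.taylorModel_add_le (hx : IsDeltaSolution f g t δ z x) (hg : ∀ x, g x ≠ ⊥)
    {y : EuclideanSpace ℝ (Fin n)} (hy : y ∈ domF f g) :
    taylorModel (realPart f) z x + t⁻¹ * realPart g x ≤
      taylorModel (realPart f) z y + t⁻¹ * realPart g y + δ ^ 2 / 2 := by
  have hle := hx.2 y hy
  rwa [modelObjective_eq_coe hg t hx.1.2, modelObjective_eq_coe hg t hy.2, ← EReal.coe_add,
    EReal.coe_le_coe_iff] at hle

end ExtendedReal

end ProxNewton

open ProxNewton in
theorem theorem3p2_general {E : Type*} [NormedAddCommGroup E] [NormedSpace ℝ E] {F G : E → ℝ}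
    {U V : Set E} {δ : ℝ} {z xplus xstar : E} (hF : SelfConcordantOn F U)
    (hG : ConvexOn ℝ V G) (hδ : 0 ≤ δ) (hzU : z ∈ U) (hxstarU : xstar ∈ U) (hxstarV : xstar ∈ V)
    (hmin : IsLocalMinOn (fun x => F x + G x) V xstar) (hxplus : xplus ∈ V)
    (hmodel : taylorModel F z xplus + G xplus ≤
      taylorModel F z xstar + G xstar + δ ^ 2 / 2)
    (hlam : hessNorm F xstar (z - xstar) < 1) :
    hessNorm F xstar (xplus - xstar) ≤
      δ / (1 - hessNorm F xstar (z - xstar)) +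
        2 * hessNorm F xstar (z - xstar) ^ 2 /
          (1 - hessNorm F xstar (z - xstar)) ^ 4 := by
  set D := hessNorm F xstar (xplus - xstar)
  set lam := hessNorm F xstar (z - xstar)
  have hpos : 0 < 1 - lam := sub_pos.2 hlam
  have optimality := fderiv_sub_add_sub_nonneg_of_isLocalMinOn
    ((hF.contDiffAt hxstarU).differentiableAt three_ne_zero) hG hmin hxstarV hxplus
  have comparison := taylorModel_sub_taylorModel (hF.contDiffAt hzU) (x := xstar)
    (y := xplus)
  have gradient := (abs_le.1
    (hF.abs_fderiv_sub_sub_hessian_le hxstarU hzU hlam (xplus - xstar))).1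
  have metric := hF.hessNorm_mul_one_sub_le hxstarU hzU hlam (xplus - xstar)
  have quadratic : (D * (1 - lam)) ^ 2 ≤
      δ ^ 2 + 2 * (lam ^ 2 / (1 - lam) ^ 3) * (D * (1 - lam)) := by
    have hsq := pow_le_pow_left₀ (mul_nonneg (hessNorm_nonneg F _ _) hpos.le) metric 2
    have hD : lam ^ 2 / (1 - lam) ^ 3 * (D * (1 - lam)) = (lam / (1 - lam)) ^ 2 * D := by field_simp
    rw [hF.sq_hessNorm hzU] at hsq
    linarith
  have hR : 0 ≤ lam ^ 2 / (1 - lam) ^ 3 := by positivity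
  calc D = D * (1 - lam) / (1 - lam) := by field_simp
    _ ≤ (δ + 2 * (lam ^ 2 / (1 - lam) ^ 3)) / (1 - lam) := by
      gcongr
      exact le_add_two_mul_of_sq_le hδ hR quadratic
    _ = δ / (1 - lam) + 2 * lam ^ 2 / (1 - lam) ^ 4 := by field_simp

theorem theorem3p2 {n : ℕ} (f g : EuclideanSpace ℝ (Fin n) → EReal) (ν t δ : ℝ)
    (hf : ProxNewton.IsSelfConcordantBarrier ν f)
    (hg : ProxNewton.IsProperLscConvex g)
    (ht : 0 < t) (hδ : 0 ≤ δ)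
    (xt xplus xstar : EuclideanSpace ℝ (Fin n))
    (hxt : xt ∈ ProxNewton.domF f g)
    (hxstar : ProxNewton.IsSolution f g t xstar)
    (hpos : ProxNewton.HessPosDef f xstar)
    (hxplus : ProxNewton.IsDeltaSolution f g t δ xt xplus) :
    (ProxNewton.localNorm f xstar (xt - xstar) ∈ Set.Ico (0 : ℝ) (1 - Real.sqrt 2 / 2) →
      ProxNewton.localNorm f xstar (xplus - xstar) ≤
        ProxNewton.contractionBound δ (ProxNewton.localNorm f xstar (xt - xstar))) ∧
    (∀ δ' : ℝ, 0 ≤ δ' →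
      MonotoneOn (fun lam : ℝ => ProxNewton.contractionBound δ' lam)
        (Set.Ico (0 : ℝ) (1 - Real.sqrt 2 / 2))) ∧
    (∀ lam ∈ Set.Ico (0 : ℝ) (1 - Real.sqrt 2 / 2),
      MonotoneOn (fun δ' : ℝ => ProxNewton.contractionBound δ' lam) (Set.Ici (0 : ℝ))) := by
  refine ⟨fun hlam => ?_, fun δ' hδ' => ProxNewton.monotoneOn_contractionBound_right hδ',
    fun lam hlam => ?_⟩
  · have hlam_one : ProxNewton.localNorm f xstar (xt - xstar) < 1 := by
      linarith [ProxNewton.lt_half_of_lt_one_sub_sqrt hlam.2]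
    exact (theorem3p2_general hf.selfConcordant.selfConcordantOn
      (hg.convex.smul (inv_pos.2 ht).le) hδ hxt.1 hxstar.1.1 hxstar.1.2
      (hxstar.isLocalMinOn hf.selfConcordant hg.ne_bot) hxplus.1.2
      (hxplus.taylorModel_add_le hg.ne_bot hxstar.1) hlam_one).trans
      (ProxNewton.le_contractionBound hlam.2)
  · exact (ProxNewton.monotone_contractionBound_left
      (by linarith [ProxNewton.lt_half_of_lt_one_sub_sqrt hlam.2])).monotoneOn _
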